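/- Let $d\ge 1$ be an integer, let $1\le p\le q\le\infty$ and $s,s'\in\mathbb{R}$, with the convention $1/\infty=0$. For a Lebesgue measurable real- or complex-valued function $f$ on $\mathbb{R}^d$ put $\|f\|_{L^p_s}:=\big\||\cdot|^s f\big\|_{L^p(\mathbb{R}^d)}\in[0,\infty]$ (for $p=\infty$ this is the essential supremum of $|x|^s|f(x)|$), and let $L^p_s(\mathbb{R}^d)$ be the set of Lebesgue measurable $f$ with $\|f\|_{L^p_s}<\infty$. For $t>0$ let $g_t(x):=(4\pi t)^{-d/2}e^{-|x|^2/(4t)}$ and $e^{t\Delta}f:=g_t*f$; this is well defined at $x$ if $y\mapsto g_t(x-y)f(y)$ is integrable. Consider the condition $$-\frac dq<s'\le s<d\Big(1-\frac1p\Big),\qquad(\ast)$$ where, if $q=\infty$, the lower bound $-\frac dq<s'$ is replaced by $0\le s'$, and, if $p=1$, the upper bound $s<d(1-\frac1p)$ is replaced by $s\le 0$ (in particular $(\ast)$ means $s'=s=0$ when $p=1$ and $q=\infty$). (a) If $(\ast)$ holds, then there is a constant $C>0$ depending only on $d,p,q,s,s'$ such that for all $f\in L^p_s(\mathbb{R}^d)$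 and all $t>0$ the function $e^{t\Delta}f$ is well defined at every point of $\mathbb{R}^d$, belongs to $L^q_{s'}(\mathbb{R}^d)$, and satisfies $$\|e^{t\Delta}f\|_{L^q_{s'}}\le C\,t^{-\frac d2\left(\frac1p-\frac1q\right)-\frac{s-s'}2}\,\|f\|_{L^p_s}.$$ (b) Condition $(\ast)$ is optimal: if $(\ast)$ fails, then for every $t>0$ there is no constant $C$ such that, for all $f\in L^p_s(\mathbb{R}^d)$, the function $e^{t\Delta}f$ is well defined almost everywhere and $\|e^{t\Delta}f\|_{L^q_{s'}}\le C\|f\|_{L^p_s}$. -/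

import Mathlib

open MeasureTheory
open scoped ENNReal

noncomputable section

/-- The heat kernel `g_t(x) = (4πt)^{-d/2} exp(-|x|²/(4t))` on `ℝ^d`. -/
def heatKernel (d : ℕ) (t : ℝ) (x : EuclideanSpace ℝ (Fin d)) : ℝ :=
  (4 * Real.pi * t) ^ (-(d : ℝ) / 2) * Real.exp (-‖x‖ ^ 2 / (4 * t))

/-- `(g_t ∗ f)(x)` is well defined: `y ↦ g_t(y) f(x - y)` is Lebesgue integrable. -/
def HeatDefinedAt {𝕜 : Type*} [RCLike 𝕜] {d : ℕ} (t : ℝ)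
    (f : EuclideanSpace ℝ (Fin d) → 𝕜) (x : EuclideanSpace ℝ (Fin d)) : Prop :=
  ConvolutionExistsAt (heatKernel d t) f x (ContinuousLinearMap.lsmul ℝ ℝ) volume

/-- The heat semigroup `e^{tΔ} f = g_t ∗ f` (Bochner convolution; the value is meaningful at the
points `x` where `HeatDefinedAt t f x` holds). -/
def heatSemigroup {𝕜 : Type*} [RCLike 𝕜] {d : ℕ} (t : ℝ)
    (f : EuclideanSpace ℝ (Fin d) → 𝕜) : EuclideanSpace ℝ (Fin d) → 𝕜 :=
  convolution (heatKernel d t) f (ContinuousLinearMap.lsmul ℝ ℝ) volume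

/-- The weighted norm `‖f‖_{L^p_s} = ‖ |x|^s f ‖_{L^p(ℝ^d)}`, with values in `[0,∞]`; for `p = ∞`
it is the essential supremum of `|x|^s |f(x)|`. -/
def weightedNorm {𝕜 : Type*} [RCLike 𝕜] {d : ℕ} (f : EuclideanSpace ℝ (Fin d) → 𝕜)
    (p : ℝ≥0∞) (s : ℝ) : ℝ≥0∞ :=
  eLpNorm (fun x => ‖x‖ ^ s * ‖f x‖) p volume

/-- `f ∈ L^p_s(ℝ^d)`: `f` is Lebesgue measurable and its weighted norm is finite. -/
def MemWeightedLp {𝕜 : Type*} [RCLike 𝕜] {d : ℕ} (f : EuclideanSpace ℝ (Fin d) → 𝕜)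
    (p : ℝ≥0∞) (s : ℝ) : Prop :=
  AEStronglyMeasurable f volume ∧ weightedNorm f p s < ∞

/-- The condition `-d/q < s' ≤ s < d(1 - 1/p)` (with `1/∞ = 0`), where the lower bound is relaxed to
`0 ≤ s'` if `q = ∞` and the upper bound is relaxed to `s ≤ 0` if `p = 1`. -/
def AdmissibleWeights (d : ℕ) (p q : ℝ≥0∞) (s s' : ℝ) : Prop :=
  (-(d : ℝ) * (q⁻¹).toReal < s' ∨ (q = ∞ ∧ 0 ≤ s')) ∧ s' ≤ s ∧
    (s < (d : ℝ) * (1 - (p⁻¹).toReal) ∨ (p = 1 ∧ s ≤ 0))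

end

/-!
Write `F = |·|^s f`, so that the estimate concerns the integral operator with kernel
`K(x, y) = |x|^{s'} g_t(x - y) |y|^{-s}` acting from `L^p` to `L^q`. By parabolic scaling
(`heatSemigroup_sqrt_smul`, `weightedNorm_comp_smul`) it suffices to treat `t = 1`. The kernel is
then bounded (`exists_weighted_gaussian_le`) by a multiple of `A(x) B(y) + G(x - y)`, where
`A = |·|^{s'} e^{-|·|²/8}`, `B = |·|^{-s} e^{-|·|²/8}` and `G = e^{-|·|²/8}`: the product controls the
region where `x` or `y` is in the unit ball, and Peetre's inequality, which is where `s' ≤ s` enters,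
controls the rest. The two strict (or endpoint) inequalities in the hypothesis say exactly that
`A ∈ L^q` and `B ∈ L^{p'}` (`eLpNorm_rpow_norm_mul_exp_lt_top`), so the product is handled by
Hölder's inequality; the convolution with `G` is bounded from `L^p` to `L^q` by a form of Young's
inequality (`eLpNorm_lintegral_sub_mul_le`), obtained from the `L^p → L^p` and `L^p → L^∞` bounds.

For the converse, a nonnegative datum `φ` supported in a ball of radius `2` evolves into a function
that is at least `c ∫ φ` on that ball, with `c` depending only on `d` and `t`
(`mul_integral_le_norm_heatSemigroup`). An estimate at one time `t` therefore bounds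
`(∫ φ) ‖|·|^{s'} 1_{ball}‖_q` by a multiple of `‖|·|^s φ‖_p`. The three parts of the condition follow
by testing this on the indicator of a small ball away from the origin
(`lower_condition_of_estimate`), on indicators of balls moving to infinity (`le_of_estimate`), and
on `|x|^{-d+ε} 1_{|x|<1}` as `ε → 0` (`upper_condition_of_estimate`).
-/

/-! ### Hölder, interpolation and Young for `ℝ≥0∞`-valued functions -/

section General

variable {α : Type*} [MeasurableSpace α] {μ : Measure α}

theorem lintegral_mul_le_eLpNorm_mul_eLpNorm {p r : ℝ≥0∞} [hpr : ENNReal.HolderConjugate r p]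
    {f g : α → ℝ≥0∞} (hf : AEMeasurable f μ) (hg : AEMeasurable g μ) :
    ∫⁻ x, f x * g x ∂μ ≤ eLpNorm f r μ * eLpNorm g p μ := by
  have top_one : ∀ f g : α → ℝ≥0∞, AEMeasurable g μ →
      ∫⁻ x, f x * g x ∂μ ≤ eLpNorm f ∞ μ * eLpNorm g 1 μ := by
    intro f g hg
    rw [eLpNorm_exponent_top, eLpNorm_one_eq_lintegral_enorm, ← lintegral_const_mul'' _ (by simpa)]
    refine lintegral_mono_ae ?_
    filter_upwards [enorm_ae_le_eLpNormEssSup f μ] with x hx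
    simpa using mul_le_mul_left hx (g x)
  have hpr' := ENNReal.holderConjugate_iff.1 hpr
  rcases eq_or_ne r ∞ with rfl | hr
  · obtain rfl : p = 1 := by simpa using hpr'
    exact top_one f g hg
  rcases eq_or_ne p ∞ with rfl | hp
  · obtain rfl : r = 1 := by simpa using hpr'
    simpa only [mul_comm] using top_one g f hf
  have hr0 : r ≠ 0 := by rintro rfl; simp at hpr'
  have hp0 : p ≠ 0 := by rintro rfl; simp at hpr'
  rw [eLpNorm_eq_lintegral_rpow_enorm_toReal hr0 hr, eLpNorm_eq_lintegral_rpow_enorm_toReal hp0 hp]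
  have hc : r.toReal.HolderConjugate p.toReal := by
    refine ⟨?_, ENNReal.toReal_pos hr0 hr, ENNReal.toReal_pos hp0 hp⟩
    rw [← ENNReal.toReal_inv, ← ENNReal.toReal_inv, ← ENNReal.toReal_add (by simpa) (by simpa),
      hpr']
    simp
  simpa using ENNReal.lintegral_mul_le_Lp_mul_Lq μ hc hf hg

/-- Log-convexity of the `L^p` norms between `p` and `∞`, for a common bound. -/
theorem eLpNorm_le_of_eLpNorm_le_of_le {h : α → ℝ≥0∞} {p q N : ℝ≥0∞} (hp : p ≠ 0)
    (hpq : p ≤ q) (hsup : ∀ x, h x ≤ N) (hN : p ≠ ∞ → eLpNorm h p μ ≤ N) : eLpNorm h q μ ≤ N := by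
  rcases eq_or_ne q ∞ with rfl | hq
  · rw [eLpNorm_exponent_top]
    exact essSup_le_of_ae_le _ (.of_forall fun x => by simpa using hsup x)
  have hp' : p ≠ ∞ := ne_top_of_le_ne_top hq hpq
  have hq0 : q ≠ 0 := (hp.bot_lt.trans_le hpq).ne'
  have hpr : 0 < p.toReal := ENNReal.toReal_pos hp hp'
  have hqr : 0 < q.toReal := ENNReal.toReal_pos hq0 hq
  have hle : p.toReal ≤ q.toReal := ENNReal.toReal_mono hq hpq
  specialize hN hp'
  rw [eLpNorm_eq_lintegral_rpow_enorm_toReal hp hp', one_div, ENNReal.rpow_inv_le_iff hpr] at hN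
  rw [eLpNorm_eq_lintegral_rpow_enorm_toReal hq0 hq, one_div, ENNReal.rpow_inv_le_iff hqr]
  rcases eq_or_ne N ∞ with rfl | hNt
  · simp [hqr]
  have split : ∀ a : ℝ≥0∞, a ^ q.toReal = a ^ (q.toReal - p.toReal) * a ^ p.toReal := by
    intro a
    rw [← ENNReal.rpow_add_of_nonneg _ _ (by linarith) hpr.le]; simp
  calc ∫⁻ x, ‖h x‖ₑ ^ q.toReal ∂μ
      ≤ ∫⁻ x, N ^ (q.toReal - p.toReal) * ‖h x‖ₑ ^ p.toReal ∂μ := by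
        refine lintegral_mono fun x => ?_
        simp only [enorm_eq_self]
        rw [split]
        gcongr
        exact hsup x
    _ = N ^ (q.toReal - p.toReal) * ∫⁻ x, ‖h x‖ₑ ^ p.toReal ∂μ :=
        lintegral_const_mul' _ _ (ENNReal.rpow_ne_top_of_nonneg (by linarith) hNt)
    _ ≤ _ := by rw [split N]; gcongr

end General

section Young

variable {E : Type*} [NormedAddCommGroup E] [InnerProductSpace ℝ E] [FiniteDimensional ℝ E]
  [MeasurableSpace E] [BorelSpace E]

theorem aemeasurable_lintegral_sub_mul {G F : E → ℝ≥0∞} (hG : Measurable G)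
    (hF : AEMeasurable F volume) :
    AEMeasurable (fun x => ∫⁻ y, G (x - y) * F y) (volume : Measure E) := by
  have : ∀ x, ∫⁻ y, G (x - y) * F y = ∫⁻ y, G (x - y) * hF.mk F y := fun x =>
    lintegral_congr_ae (hF.ae_eq_mk.mono fun y hy => by simp only [hy])
  simp_rw [this]
  have hm := hF.measurable_mk
  exact (Measurable.lintegral_prod_right' (f := fun z : E × E => G (z.1 - z.2) * hF.mk F z.2)
    (by fun_prop)).aemeasurable

/-- Convolution with an integrable function is bounded on `L^p`: by Hölder with the weights
`1/p` and `1 - 1/p`, `(G ∗ F)^p ≤ ‖G‖₁^{p-1} (G ∗ F^p)` pointwise. -/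
theorem eLpNorm_lintegral_sub_mul_le_self {p : ℝ≥0∞} (hp : 1 ≤ p) (hp' : p ≠ ∞)
    {G F : E → ℝ≥0∞} (hG : Measurable G) (hF : AEMeasurable F volume) :
    eLpNorm (fun x => ∫⁻ y, G (x - y) * F y) p (volume : Measure E) ≤
      (∫⁻ y, G y) * eLpNorm F p volume := by
  have hp0 : p ≠ 0 := (zero_lt_one.trans_le hp).ne'
  have hpr : 0 < p.toReal := ENNReal.toReal_pos hp0 hp'
  have hp1 : 1 ≤ p.toReal := by simpa using ENNReal.toReal_mono hp' hp
  have hGs : ∀ x : E, ∫⁻ y, G (x - y) = ∫⁻ y, G y := fun x =>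
    lintegral_sub_left_eq_self G x
  have hpt : ∀ x : E, (∫⁻ y, G (x - y) * F y) ^ p.toReal ≤
      (∫⁻ y, G y) ^ (p.toReal - 1) * ∫⁻ y, G (x - y) * F y ^ p.toReal := by
    intro x
    have h := ENNReal.lintegral_mul_norm_pow_le (μ := (volume : Measure E))
      (f := fun y => G (x - y) * F y ^ p.toReal)
      (g := fun y => G (x - y)) (by fun_prop) (by fun_prop)
      (p := p.toReal⁻¹) (q := 1 - p.toReal⁻¹) (by positivity)
      (sub_nonneg.2 (inv_le_one_of_one_le₀ hp1)) (by ring)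
    have e : ∀ y, (G (x - y) * F y ^ p.toReal) ^ p.toReal⁻¹ * G (x - y) ^ (1 - p.toReal⁻¹)
        = G (x - y) * F y := by
      intro y
      rw [ENNReal.mul_rpow_of_nonneg _ _ (by positivity), ENNReal.rpow_rpow_inv hpr.ne',
        mul_right_comm, ← ENNReal.rpow_add_of_nonneg _ _ (by positivity)
        (sub_nonneg.2 (inv_le_one_of_one_le₀ hp1))]
      simp
    simp only [e, hGs] at h
    refine (ENNReal.rpow_le_rpow h hpr.le).trans (le_of_eq ?_)
    rw [ENNReal.mul_rpow_of_nonneg _ _ hpr.le, ENNReal.rpow_inv_rpow hpr.ne', ← ENNReal.rpow_mul,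
      mul_comm]
    congr 2
    field_simp
  rw [eLpNorm_eq_lintegral_rpow_enorm_toReal hp0 hp', eLpNorm_eq_lintegral_rpow_enorm_toReal hp0 hp',
    one_div, ENNReal.rpow_inv_le_iff hpr, ENNReal.mul_rpow_of_nonneg _ _ hpr.le,
    ENNReal.rpow_inv_rpow hpr.ne']
  simp only [enorm_eq_self]
  have hmeas := aemeasurable_lintegral_sub_mul hG (hF.pow_const p.toReal)
  have hswap : ∫⁻ x, ∫⁻ y, G (x - y) * F y ^ p.toReal = (∫⁻ y, G y) * ∫⁻ y, F y ^ p.toReal := by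
    have : ∀ x, ∫⁻ y, G (x - y) * F y ^ p.toReal
        = ∫⁻ y, G (x - y) * (hF.mk F y) ^ p.toReal := fun x =>
      lintegral_congr_ae (hF.ae_eq_mk.mono fun y hy => by simp only [hy])
    simp_rw [this]
    have hm := hF.measurable_mk
    rw [lintegral_lintegral_swap (by fun_prop)]
    have h2 : ∀ y, ∫⁻ x, G (x - y) * (hF.mk F y) ^ p.toReal
        = (∫⁻ y, G y) * (hF.mk F y) ^ p.toReal := by
      intro y
      rw [lintegral_mul_const _ (by fun_prop), lintegral_sub_right_eq_self G y]
    simp_rw [h2]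
    rw [lintegral_const_mul _ (by fun_prop)]
    congr 1
    exact lintegral_congr_ae (hF.ae_eq_mk.mono fun y hy => by simp only [hy])
  calc ∫⁻ x, (∫⁻ y, G (x - y) * F y) ^ p.toReal
      ≤ ∫⁻ x, (∫⁻ y, G y) ^ (p.toReal - 1) * ∫⁻ y, G (x - y) * F y ^ p.toReal :=
        lintegral_mono hpt
    _ = (∫⁻ y, G y) ^ (p.toReal - 1) * ((∫⁻ y, G y) * ∫⁻ y, F y ^ p.toReal) := by
        rw [lintegral_const_mul'' _ hmeas, hswap]
    _ = _ := by
        rw [← mul_assoc]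
        congr 1
        nth_rewrite 2 [← ENNReal.rpow_one (∫⁻ y, G y)]
        rw [← ENNReal.rpow_add_of_nonneg _ _ (by linarith) zero_le_one]
        simp

/-- A form of Young's inequality: convolution with a kernel in `L^1 ∩ L^{p'}` maps `L^p` into `L^q`
for every `q ≥ p`. -/
theorem eLpNorm_lintegral_sub_mul_le {p q r : ℝ≥0∞} [hpr : ENNReal.HolderConjugate r p]
    (hp : 1 ≤ p) (hpq : p ≤ q) {G F : E → ℝ≥0∞} (hG : Measurable G) (hF : AEMeasurable F volume) :
    eLpNorm (fun x => ∫⁻ y, G (x - y) * F y) q (volume : Measure E) ≤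
      max (∫⁻ y, G y) (eLpNorm G r volume) * eLpNorm F p volume := by
  refine eLpNorm_le_of_eLpNorm_le_of_le (zero_lt_one.trans_le hp).ne' hpq (fun x => ?_) fun hp' => ?_
  · refine (lintegral_mul_le_eLpNorm_mul_eLpNorm (r := r) (p := p) (by fun_prop) hF).trans ?_
    have : eLpNorm (fun y => G (x - y)) r volume = eLpNorm G r volume :=
      eLpNorm_comp_measurePreserving (g := G) (f := fun y => x - y)
        hG.aestronglyMeasurable (Measure.measurePreserving_sub_left volume x)
    rw [this]
    gcongr
    exact le_max_right _ _
  · refine (eLpNorm_lintegral_sub_mul_le_self hp hp' hG hF).trans ?_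
    gcongr
    exact le_max_left _ _

end Young

/-! ### Power weights and Gaussian-damped power weights -/

/-- A Gaussian absorbs every nonnegative power. -/
theorem exists_rpow_mul_exp_neg_mul_sq_le {a c : ℝ} (ha : 0 ≤ a) (hc : 0 < c) :
    ∃ M, 0 < M ∧ ∀ x : ℝ, 0 ≤ x → x ^ a * Real.exp (-(c * x ^ 2)) ≤ M := by
  rcases ha.eq_or_lt with rfl | ha
  · refine ⟨1, one_pos, fun x hx => ?_⟩
    rw [Real.rpow_zero, one_mul, Real.exp_le_one_iff]
    have := mul_nonneg hc.le (sq_nonneg x)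
    linarith
  set b := a / 2 with hb
  have hb0 : 0 < b := by positivity
  refine ⟨(b / c) ^ b, by positivity, fun x hx => ?_⟩
  -- `u ≤ (b / c) * exp (c * u / b)` for `u = x ^ 2`, raised to the power `b`
  have h1 : x ^ 2 ≤ b / c * Real.exp (c * x ^ 2 / b) := by
    have := Real.add_one_le_exp (c * x ^ 2 / b)
    calc x ^ 2 = b / c * (c * x ^ 2 / b) := by field_simp
      _ ≤ _ := by gcongr; linarith
  have h2 := Real.rpow_le_rpow (by positivity) h1 hb0.le
  rw [Real.mul_rpow (by positivity) (by positivity), ← Real.exp_mul, ← Real.rpow_natCast,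
    ← Real.rpow_mul hx] at h2
  have e1 : ((2 : ℕ) : ℝ) * b = a := by rw [hb]; push_cast; ring
  have e2 : c * x ^ 2 / b * b = c * x ^ 2 := by field_simp
  rw [e1, Real.rpow_natCast, e2] at h2
  rw [Real.exp_neg, ← div_eq_mul_inv, div_le_iff₀ (Real.exp_pos _)]
  exact h2

section Weights

variable {d : ℕ}

theorem rpow_natCast_sub_one_add (hd : 1 ≤ d) {y : ℝ} (hy : 0 < y) (b : ℝ) :
    y ^ ((d : ℝ) - 1 + b) = y ^ (d - 1) * y ^ b := by
  rw [Real.rpow_add hy, ← Real.rpow_natCast y (d - 1), Nat.cast_sub hd, Nat.cast_one]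

/-- The weight `|x|^a e^{-c|x|²}` is in `L^r` as soon as `|x|^a` is locally in `L^r`. -/
theorem eLpNorm_rpow_norm_mul_exp_lt_top (hd : 1 ≤ d) {a c : ℝ} (hc : 0 < c) {r : ℝ≥0∞}
    (hr : r ≠ 0) (h : -(d : ℝ) * (r⁻¹).toReal < a ∨ (r = ∞ ∧ 0 ≤ a)) :
    eLpNorm (fun x : EuclideanSpace ℝ (Fin d) => ‖x‖ ^ a * Real.exp (-(c * ‖x‖ ^ 2))) r volume
      < ∞ := by
  have : Nonempty (Fin d) := ⟨⟨0, hd⟩⟩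
  rcases eq_or_ne r ∞ with rfl | hr'
  · have ha : 0 ≤ a := by
      rcases h with h | h
      · simp at h; exact h.le
      · exact h.2
    obtain ⟨M, -, hM⟩ := exists_rpow_mul_exp_neg_mul_sq_le ha hc
    rw [eLpNorm_exponent_top]
    refine eLpNormEssSup_lt_top_of_ae_bound (C := M) (.of_forall fun x => ?_)
    rw [Real.norm_of_nonneg (by positivity)]
    exact hM _ (norm_nonneg x)
  · have h : -(d : ℝ) * (r⁻¹).toReal < a := h.resolve_right fun h => hr' h.1
    have hrr : 0 < r.toReal := ENNReal.toReal_pos hr hr'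
    have key : MemLp (fun x : EuclideanSpace ℝ (Fin d) => ‖x‖ ^ a * Real.exp (-(c * ‖x‖ ^ 2)))
        r volume := by
      rw [← integrable_norm_rpow_iff (by fun_prop) hr hr']
      have e : ∀ x : EuclideanSpace ℝ (Fin d),
          ‖‖x‖ ^ a * Real.exp (-(c * ‖x‖ ^ 2))‖ ^ r.toReal
          = (fun y : ℝ => y ^ (a * r.toReal) * Real.exp (-(c * r.toReal) * y ^ 2)) ‖x‖ := by
        intro x
        rw [Real.norm_of_nonneg (by positivity), Real.mul_rpow (by positivity) (by positivity),
          ← Real.rpow_mul (norm_nonneg x), ← Real.exp_mul]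
        ring_nf
      simp_rw [e]
      rw [integrable_fun_norm_addHaar volume
        (f := fun y : ℝ => y ^ (a * r.toReal) * Real.exp (-(c * r.toReal) * y ^ 2))]
      have hs : -1 < (d : ℝ) - 1 + a * r.toReal := by
        rw [ENNReal.toReal_inv] at h
        have := mul_lt_mul_of_pos_right h hrr
        rw [mul_assoc, inv_mul_cancel₀ hrr.ne'] at this
        linarith
      refine (integrableOn_rpow_mul_exp_neg_mul_sq (mul_pos hc hrr) hs).congr_fun
        (fun y (hy : 0 < y) => ?_) measurableSet_Ioi
      simp only [finrank_euclideanSpace, Fintype.card_fin, smul_eq_mul]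
      rw [rpow_natCast_sub_one_add hd hy, mul_assoc]
    exact key.2

/-- `|x|^b` is integrable near the origin of `ℝ^d` exactly for `b > -d`. -/
theorem integrableOn_ball_rpow_norm_iff (hd : 1 ≤ d) {b : ℝ} :
    IntegrableOn (fun x : EuclideanSpace ℝ (Fin d) => ‖x‖ ^ b) (Metric.ball 0 1) volume ↔
      -(d : ℝ) < b := by
  have : Nonempty (Fin d) := ⟨⟨0, hd⟩⟩
  rw [integrableOn_fun_norm_addHaar volume (f := fun y : ℝ => y ^ b)]
  rw [show (-(d : ℝ) < b) ↔ -1 < (d : ℝ) - 1 + b by constructor <;> intro h <;> linarith,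
    ← intervalIntegral.integrableOn_Ioo_rpow_iff zero_lt_one]
  refine integrableOn_congr_fun (fun y hy => ?_) measurableSet_Ioo
  simp only [finrank_euclideanSpace, Fintype.card_fin, smul_eq_mul]
  rw [rpow_natCast_sub_one_add hd hy.1]

theorem integral_ball_rpow_norm (hd : 1 ≤ d) {b : ℝ} (hb : -(d : ℝ) < b) :
    ∫ x in Metric.ball (0 : EuclideanSpace ℝ (Fin d)) 1, ‖x‖ ^ b =
      d * volume.real (Metric.ball (0 : EuclideanSpace ℝ (Fin d)) 1) / (d + b) := by
  have : Nonempty (Fin d) := ⟨⟨0, hd⟩⟩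
  have e : ∀ x : EuclideanSpace ℝ (Fin d), (Metric.ball 0 1).indicator (fun x => ‖x‖ ^ b) x =
      (Set.Iio 1).indicator (fun y : ℝ => y ^ b) ‖x‖ := by
    intro x; simp [Set.indicator]
  rw [← integral_indicator measurableSet_ball]
  simp_rw [e]
  rw [integral_fun_norm_addHaar volume ((Set.Iio 1).indicator (fun y : ℝ => y ^ b))]
  have e2 : ∫ y in Set.Ioi (0 : ℝ), y ^ (Module.finrank ℝ (EuclideanSpace ℝ (Fin d)) - 1) •
      (Set.Iio 1).indicator (fun y : ℝ => y ^ b) y = 1 / (d + b) := by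
    have : ∀ y ∈ Set.Ioi (0 : ℝ), y ^ (Module.finrank ℝ (EuclideanSpace ℝ (Fin d)) - 1) •
        (Set.Iio 1).indicator (fun y : ℝ => y ^ b) y =
        (Set.Iio 1).indicator (fun y : ℝ => y ^ ((d : ℝ) - 1 + b)) y := by
      intro y (hy : 0 < y)
      simp only [finrank_euclideanSpace, Fintype.card_fin, smul_eq_mul, Set.indicator_apply]
      split_ifs
      · rw [rpow_natCast_sub_one_add hd hy]
      · simp
    rw [setIntegral_congr_fun measurableSet_Ioi this, setIntegral_indicator measurableSet_Iio,
      Set.Ioi_inter_Iio, ← integral_Ioc_eq_integral_Ioo,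
      ← intervalIntegral.integral_of_le zero_le_one, integral_rpow (Or.inl (by linarith))]
    have : (d : ℝ) - 1 + b + 1 = d + b := by ring
    rw [this, Real.zero_rpow (by linarith)]
    simp
  rw [e2]
  simp only [finrank_euclideanSpace, Fintype.card_fin, smul_eq_mul, nsmul_eq_mul]
  ring

/-- The weight `|x|^a` is not in `L^q` near the origin when the lower bound on `a` fails. -/
theorem eLpNorm_indicator_ball_rpow_norm_eq_top (hd : 1 ≤ d) {a : ℝ} {q : ℝ≥0∞} (hq : q ≠ 0)
    (h : ¬ (-(d : ℝ) * (q⁻¹).toReal < a ∨ (q = ∞ ∧ 0 ≤ a))) :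
    eLpNorm ((Metric.ball (0 : EuclideanSpace ℝ (Fin d)) 1).indicator fun x => ‖x‖ ^ a) q volume
      = ∞ := by
  have : Nonempty (Fin d) := ⟨⟨0, hd⟩⟩
  push Not at h
  by_contra hcon
  have hm : AEStronglyMeasurable
      ((Metric.ball (0 : EuclideanSpace ℝ (Fin d)) 1).indicator fun x => ‖x‖ ^ a) volume :=
    (Measurable.indicator (by fun_prop) measurableSet_ball).aestronglyMeasurable
  have hmem : MemLp ((Metric.ball (0 : EuclideanSpace ℝ (Fin d)) 1).indicator fun x => ‖x‖ ^ a)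
      q volume := ⟨hm, lt_top_iff_ne_top.2 hcon⟩
  rcases eq_or_ne q ∞ with rfl | hq'
  · have ha : a < 0 := h.2 rfl
    -- an essential bound `M` fails on the ball where `|x|^a > M`
    rw [eLpNorm_exponent_top] at hcon
    set M := (eLpNormEssSup ((Metric.ball (0 : EuclideanSpace ℝ (Fin d)) 1).indicator
      fun x => ‖x‖ ^ a) volume).toReal with hM
    have hM0 : 0 ≤ M := ENNReal.toReal_nonneg
    have hae : ∀ᵐ x : EuclideanSpace ℝ (Fin d), x ∈ Metric.ball 0 1 → ‖x‖ ^ a ≤ M := by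
      filter_upwards [enorm_ae_le_eLpNormEssSup ((Metric.ball (0 : EuclideanSpace ℝ (Fin d))
        1).indicator fun x => ‖x‖ ^ a) volume] with x hx hxb
      rw [Set.indicator_of_mem hxb] at hx
      have := ENNReal.toReal_mono hcon hx
      simpa [abs_of_nonneg (Real.rpow_nonneg (norm_nonneg x) a)] using this
    set δ := min 1 ((M + 1) ^ a⁻¹) with hδ
    have hδ0 : 0 < δ := by positivity
    have hsub : ∀ᵐ x : EuclideanSpace ℝ (Fin d), x ∉ Metric.ball 0 δ := by
      filter_upwards [hae, Measure.ae_ne volume (0 : EuclideanSpace ℝ (Fin d))] with x hx hx0 hxb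
      have hxδ : ‖x‖ < δ := by simpa using hxb
      have h1 := hx (by simpa using hxδ.trans_le (min_le_left _ _))
      have h2 : ‖x‖ ≤ (M + 1) ^ a⁻¹ := (hxδ.trans_le (min_le_right _ _)).le
      have h3 := Real.rpow_le_rpow_of_nonpos (norm_pos_iff.2 hx0) h2 ha.le
      rw [← Real.rpow_mul (by positivity), inv_mul_cancel₀ ha.ne, Real.rpow_one] at h3
      linarith
    have := (measure_eq_zero_iff_ae_notMem).2 hsub
    exact (Metric.measure_ball_pos volume (0 : EuclideanSpace ℝ (Fin d)) hδ0).ne' this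
  · have hrr : 0 < q.toReal := ENNReal.toReal_pos hq hq'
    rw [← integrable_norm_rpow_iff hm hq hq'] at hmem
    have e : (fun x => ‖(Metric.ball (0 : EuclideanSpace ℝ (Fin d)) 1).indicator
        (fun x => ‖x‖ ^ a) x‖ ^ q.toReal) =
        (Metric.ball (0 : EuclideanSpace ℝ (Fin d)) 1).indicator
          (fun x => ‖x‖ ^ (a * q.toReal)) := by
      funext x
      by_cases hx : x ∈ Metric.ball (0 : EuclideanSpace ℝ (Fin d)) 1
      · rw [Set.indicator_of_mem hx, Set.indicator_of_mem hx, Real.norm_of_nonneg (by positivity), ← Real.rpow_mul (norm_nonneg x)]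
      · simp [Set.indicator_of_notMem hx, hrr.ne']
    rw [e, integrable_indicator_iff measurableSet_ball, integrableOn_ball_rpow_norm_iff hd] at hmem
    have h1 := mul_le_mul_of_nonneg_right h.1 hrr.le
    rw [ENNReal.toReal_inv, mul_assoc, inv_mul_cancel₀ hrr.ne'] at h1
    linarith

end Weights

/-! ### The kernel bound and the weighted estimate -/

section KernelBound

variable {E : Type*} [NormedAddCommGroup E]

theorem sq_norm_le_two_mul_sq_norm_sub (x y : E) : ‖y‖ ^ 2 ≤ 2 * ‖x - y‖ ^ 2 + 2 * ‖x‖ ^ 2 := by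
  have h : ‖y‖ ≤ ‖x‖ + ‖x - y‖ := by
    simpa [norm_sub_rev] using norm_le_norm_add_norm_sub' y x
  nlinarith [norm_nonneg y, norm_nonneg x, norm_nonneg (x - y), sq_nonneg (‖x‖ - ‖x - y‖)]

/-- Peetre's inequality. -/
theorem rpow_norm_mul_rpow_neg_norm_le {x y : E} (hx : 1 ≤ ‖x‖) (hy : 1 ≤ ‖y‖) (s : ℝ) :
    ‖x‖ ^ s * ‖y‖ ^ (-s) ≤ (1 + ‖x - y‖) ^ |s| := by
  have ratio : ∀ u v : E, 1 ≤ ‖v‖ → ‖u‖ / ‖v‖ ≤ 1 + ‖u - v‖ := by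
    intro u v hv
    rw [div_le_iff₀ (by linarith)]
    have : ‖u‖ ≤ ‖v‖ + ‖u - v‖ := norm_le_norm_add_norm_sub' u v
    nlinarith [norm_nonneg (u - v)]
  have hx0 : 0 < ‖x‖ := by linarith
  have hy0 : 0 < ‖y‖ := by linarith
  rcases le_total 0 s with hs | hs
  · rw [Real.rpow_neg hy0.le, ← div_eq_mul_inv, ← Real.div_rpow hx0.le hy0.le, abs_of_nonneg hs]
    exact Real.rpow_le_rpow (by positivity) (ratio x y hy) hs
  · have e : ‖x‖ ^ s * ‖y‖ ^ (-s) = (‖y‖ / ‖x‖) ^ (-s) := by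
      rw [Real.div_rpow hy0.le hx0.le, Real.rpow_neg hx0.le s, div_inv_eq_mul, mul_comm]
    rw [e, abs_of_nonpos hs, norm_sub_rev]
    exact Real.rpow_le_rpow (by positivity) (ratio y x hx) (by linarith)

/-- If `x` or `y` is in the unit ball, the Gaussian `e^{-|x-y|²/4}` decouples into a product;
otherwise Peetre's inequality reduces the weighted kernel to a function of `x - y`. -/
theorem exists_weighted_gaussian_le {s s' : ℝ} (hs : s' ≤ s) : ∃ M : ℝ, 0 < M ∧ ∀ x y : E,
    x ≠ 0 → y ≠ 0 → ‖x‖ ^ s' * Real.exp (-(‖x - y‖ ^ 2 / 4)) * ‖y‖ ^ (-s) ≤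
      M * ((‖x‖ ^ s' * Real.exp (-(1 / 8 * ‖x‖ ^ 2))) * (‖y‖ ^ (-s) * Real.exp (-(1 / 8 * ‖y‖ ^ 2)))
        + Real.exp (-(1 / 8 * ‖x - y‖ ^ 2))) := by
  obtain ⟨M, hM0, hM⟩ := exists_rpow_mul_exp_neg_mul_sq_le (abs_nonneg s)
    (show (0 : ℝ) < 1 / 16 by norm_num)
  refine ⟨Real.exp (3 / 8) * (M + 1), by positivity, fun x y hx hy => ?_⟩
  have hx0 : 0 < ‖x‖ := norm_pos_iff.2 hx
  have hy0 : 0 < ‖y‖ := norm_pos_iff.2 hy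
  have hX : 0 < ‖x‖ ^ s' := by positivity
  have hY : 0 < ‖y‖ ^ (-s) := by positivity
  by_cases hnear : ‖x‖ ≤ 1 ∨ ‖y‖ ≤ 1
  · have hq : (‖x‖ ^ 2 + ‖y‖ ^ 2) / 8 - 3 / 8 ≤ ‖x - y‖ ^ 2 / 4 := by
      have h1 := sq_norm_le_two_mul_sq_norm_sub x y
      have h2 := sq_norm_le_two_mul_sq_norm_sub y x
      rw [norm_sub_rev y x] at h2
      rcases hnear with h | h
      · have : ‖x‖ ^ 2 ≤ 1 := by nlinarith
        linarith
      · have : ‖y‖ ^ 2 ≤ 1 := by nlinarith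
        linarith
    have hexp : Real.exp (-(‖x - y‖ ^ 2 / 4)) ≤
        Real.exp (3 / 8) * (Real.exp (-(1 / 8 * ‖x‖ ^ 2)) * Real.exp (-(1 / 8 * ‖y‖ ^ 2))) := by
      rw [← Real.exp_add, ← Real.exp_add, Real.exp_le_exp]
      linarith
    calc ‖x‖ ^ s' * Real.exp (-(‖x - y‖ ^ 2 / 4)) * ‖y‖ ^ (-s)
        ≤ ‖x‖ ^ s' * (Real.exp (3 / 8) * (Real.exp (-(1 / 8 * ‖x‖ ^ 2)) *
          Real.exp (-(1 / 8 * ‖y‖ ^ 2)))) * ‖y‖ ^ (-s) := by gcongr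
      _ = Real.exp (3 / 8) * 1 * ((‖x‖ ^ s' * Real.exp (-(1 / 8 * ‖x‖ ^ 2))) *
          (‖y‖ ^ (-s) * Real.exp (-(1 / 8 * ‖y‖ ^ 2))) + 0) := by ring
      _ ≤ _ := by
        gcongr
        · linarith
        · positivity
  · push Not at hnear
    obtain ⟨hx1, hy1⟩ := hnear
    set z := ‖x - y‖ with hz
    have hz0 : 0 ≤ z := norm_nonneg _
    have hprod : ‖x‖ ^ s' * ‖y‖ ^ (-s) ≤ (1 + z) ^ |s| :=
      (mul_le_mul_of_nonneg_right (Real.rpow_le_rpow_of_exponent_le hx1.le hs) hY.le).trans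
        (rpow_norm_mul_rpow_neg_norm_le hx1.le hy1.le s)
    have hexp : Real.exp (-(z ^ 2 / 4)) ≤
        Real.exp (3 / 8) * (Real.exp (-(1 / 16 * (1 + z) ^ 2)) * Real.exp (-(1 / 8 * z ^ 2))) := by
      rw [← Real.exp_add, ← Real.exp_add, Real.exp_le_exp]
      nlinarith [sq_nonneg (z - 1)]
    calc ‖x‖ ^ s' * Real.exp (-(z ^ 2 / 4)) * ‖y‖ ^ (-s)
        = (‖x‖ ^ s' * ‖y‖ ^ (-s)) * Real.exp (-(z ^ 2 / 4)) := by ring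
      _ ≤ (1 + z) ^ |s| * (Real.exp (3 / 8) * (Real.exp (-(1 / 16 * (1 + z) ^ 2)) *
          Real.exp (-(1 / 8 * z ^ 2)))) := by gcongr
      _ = Real.exp (3 / 8) * ((1 + z) ^ |s| * Real.exp (-(1 / 16 * (1 + z) ^ 2))) *
          (0 + Real.exp (-(1 / 8 * z ^ 2))) := by ring
      _ ≤ _ := by
        gcongr
        · linarith [hM (1 + z) (by positivity)]
        · positivity

end KernelBound

section HeatSemigroup

variable {𝕜 : Type*} [RCLike 𝕜] {d : ℕ}

theorem measurable_heatKernel (t : ℝ) : Measurable (heatKernel d t) := by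
  unfold heatKernel
  fun_prop

theorem heatKernel_nonneg {t : ℝ} (ht : 0 < t) (x : EuclideanSpace ℝ (Fin d)) :
    0 ≤ heatKernel d t x := by
  unfold heatKernel
  positivity

theorem aemeasurable_rpow_norm_mul_norm {f : EuclideanSpace ℝ (Fin d) → 𝕜}
    (hf : AEStronglyMeasurable f volume) (s : ℝ) :
    AEMeasurable (fun x => ‖x‖ ^ s * ‖f x‖) volume :=
  (Measurable.aemeasurable (by fun_prop)).mul hf.norm.aemeasurable

theorem heatSemigroup_eq_integral (t : ℝ) (f : EuclideanSpace ℝ (Fin d) → 𝕜)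
    (x : EuclideanSpace ℝ (Fin d)) :
    heatSemigroup t f x = ∫ y, heatKernel d t (x - y) • f y := by
  rw [heatSemigroup, convolution_eq_swap]
  rfl

theorem heatDefinedAt_iff (t : ℝ) (f : EuclideanSpace ℝ (Fin d) → 𝕜)
    (x : EuclideanSpace ℝ (Fin d)) :
    HeatDefinedAt t f x ↔ Integrable (fun y => heatKernel d t (x - y) • f y) volume := by
  rw [HeatDefinedAt, convolutionExistsAt_iff_integrable_swap]
  rfl

theorem aestronglyMeasurable_heatSemigroup (t : ℝ) {f : EuclideanSpace ℝ (Fin d) → 𝕜}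
    (hf : AEStronglyMeasurable f volume) : AEStronglyMeasurable (heatSemigroup t f) volume :=
  ((measurable_heatKernel t).aestronglyMeasurable.convolution_integrand
    (ContinuousLinearMap.lsmul ℝ ℝ) hf).integral_prod_right'

/-- The upper bound on `s` says that `|x|^{-s} e^{-c|x|²}` is in the dual Lebesgue space. -/
theorem exists_holderConjugate_weight (hd : 1 ≤ d) {p : ℝ≥0∞} (hp : 1 ≤ p) {s : ℝ}
    (h : s < (d : ℝ) * (1 - (p⁻¹).toReal) ∨ (p = 1 ∧ s ≤ 0)) :
    ∃ r : ℝ≥0∞, r ≠ 0 ∧ ENNReal.HolderConjugate r p ∧ ∀ c : ℝ, 0 < c →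
      eLpNorm (fun x : EuclideanSpace ℝ (Fin d) => ‖x‖ ^ (-s) * Real.exp (-(c * ‖x‖ ^ 2)))
        r volume < ∞ := by
  have hp1 : p⁻¹ ≤ 1 := ENNReal.inv_le_one.2 hp
  have hr0 : (1 - p⁻¹)⁻¹ ≠ 0 :=
    ENNReal.inv_ne_zero.2 (ne_top_of_le_ne_top ENNReal.one_ne_top tsub_le_self)
  refine ⟨(1 - p⁻¹)⁻¹, hr0, ENNReal.holderConjugate_iff.2 ?_, fun c hc => ?_⟩
  · rw [inv_inv, tsub_add_cancel_of_le hp1]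
  · refine eLpNorm_rpow_norm_mul_exp_lt_top hd hc hr0 ?_
    rw [inv_inv, ENNReal.toReal_sub_of_le hp1 ENNReal.one_ne_top, ENNReal.toReal_one]
    rcases h with h | ⟨rfl, h⟩
    · left; linarith
    · right; simpa using h

theorem heatDefinedAt_of_memWeightedLp (hd : 1 ≤ d) {p : ℝ≥0∞} (hp : 1 ≤ p) {s : ℝ}
    (h : s < (d : ℝ) * (1 - (p⁻¹).toReal) ∨ (p = 1 ∧ s ≤ 0))
    {f : EuclideanSpace ℝ (Fin d) → 𝕜} (hf : MemWeightedLp f p s) {t : ℝ} (ht : 0 < t)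
    (x : EuclideanSpace ℝ (Fin d)) : HeatDefinedAt t f x := by
  have : Nonempty (Fin d) := ⟨⟨0, hd⟩⟩
  obtain ⟨r, -, hr, hB⟩ := exists_holderConjugate_weight hd hp h
  rw [heatDefinedAt_iff]
  have hmeas := hf.1
  have hk := measurable_heatKernel (d := d) t
  refine ⟨(hk.comp (measurable_const.sub measurable_id)).aestronglyMeasurable.smul hmeas, ?_⟩
  set κ := (4 * Real.pi * t) ^ (-(d : ℝ) / 2) * Real.exp (‖x‖ ^ 2 / (4 * t)) with hκ
  set c := 1 / (8 * t) with hc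
  have hH := lintegral_mul_le_eLpNorm_mul_eLpNorm (μ := volume) (r := r) (p := p)
    (f := fun y : EuclideanSpace ℝ (Fin d) => ‖‖y‖ ^ (-s) * Real.exp (-(c * ‖y‖ ^ 2))‖ₑ)
    (g := fun y => ‖‖y‖ ^ s * ‖f y‖‖ₑ) (by fun_prop) (aemeasurable_rpow_norm_mul_norm hmeas s).enorm
  rw [eLpNorm_enorm, eLpNorm_enorm] at hH
  have hfin := hH.trans_lt (ENNReal.mul_lt_top (hB c (by positivity)) hf.2)
  rw [HasFiniteIntegral]
  refine lt_of_le_of_lt ?_ (ENNReal.mul_lt_top (a := ‖κ‖ₑ) enorm_lt_top hfin)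
  rw [← lintegral_const_mul' _ _ enorm_ne_top]
  refine lintegral_mono_ae ?_
  filter_upwards [Measure.ae_ne volume (0 : EuclideanSpace ℝ (Fin d))] with y hy
  rw [← enorm_mul, ← enorm_mul]
  rw [enorm_le_iff_norm_le]
  have hy0 : 0 < ‖y‖ := norm_pos_iff.2 hy
  rw [norm_smul, Real.norm_of_nonneg (heatKernel_nonneg ht _), Real.norm_of_nonneg (by positivity),
    heatKernel]
  have e : ‖y‖ ^ (-s) * Real.exp (-(c * ‖y‖ ^ 2)) * (‖y‖ ^ s * ‖f y‖) =
      Real.exp (-(c * ‖y‖ ^ 2)) * ‖f y‖ := by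
    have : ‖y‖ ^ (-s) * ‖y‖ ^ s = 1 := by rw [← Real.rpow_add hy0]; simp
    linear_combination Real.exp (-(c * ‖y‖ ^ 2)) * ‖f y‖ * this
  have hexp : Real.exp (-‖x - y‖ ^ 2 / (4 * t)) ≤
      Real.exp (‖x‖ ^ 2 / (4 * t)) * Real.exp (-(c * ‖y‖ ^ 2)) := by
    rw [← Real.exp_add, Real.exp_le_exp, hc, div_le_iff₀ (by positivity)]
    field_simp
    linarith [sq_norm_le_two_mul_sq_norm_sub x y]
  calc (4 * Real.pi * t) ^ (-(d : ℝ) / 2) * Real.exp (-‖x - y‖ ^ 2 / (4 * t)) * ‖f y‖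
      ≤ (4 * Real.pi * t) ^ (-(d : ℝ) / 2) *
          (Real.exp (‖x‖ ^ 2 / (4 * t)) * Real.exp (-(c * ‖y‖ ^ 2))) * ‖f y‖ := by gcongr
    _ = κ * (‖y‖ ^ (-s) * Real.exp (-(c * ‖y‖ ^ 2)) * (‖y‖ ^ s * ‖f y‖)) := by rw [e, hκ]; ring

/-- The weighted estimate at time `1`. -/
theorem exists_weightedNorm_heatSemigroup_one_le (hd : 1 ≤ d) {p q : ℝ≥0∞} (hp : 1 ≤ p)
    (hpq : p ≤ q) {s s' : ℝ} (h : AdmissibleWeights d p q s s') :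
    ∃ C : ℝ, 0 < C ∧ ∀ f : EuclideanSpace ℝ (Fin d) → 𝕜, AEStronglyMeasurable f volume →
      weightedNorm (heatSemigroup 1 f) q s' ≤ ENNReal.ofReal C * weightedNorm f p s := by
  have : Nonempty (Fin d) := ⟨⟨0, hd⟩⟩
  obtain ⟨hlow, hss, hup⟩ := h
  have hq0 : q ≠ 0 := (zero_lt_one.trans_le (hp.trans hpq)).ne'
  obtain ⟨r, hr0, hr, hB⟩ := exists_holderConjugate_weight hd hp hup
  specialize hB (1 / 8) (by norm_num)
  have hA := eLpNorm_rpow_norm_mul_exp_lt_top hd (show (0 : ℝ) < 1 / 8 by norm_num) hq0 hlow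
  have hG : ∀ r : ℝ≥0∞, r ≠ 0 →
      eLpNorm (fun x : EuclideanSpace ℝ (Fin d) => Real.exp (-(1 / 8 * ‖x‖ ^ 2))) r volume < ∞ := by
    intro r hr
    have := eLpNorm_rpow_norm_mul_exp_lt_top hd (a := 0) (show (0 : ℝ) < 1 / 8 by norm_num) hr (by
      rcases eq_or_ne r ∞ with rfl | hr'
      · right; simp
      · left
        have : 0 < (r⁻¹).toReal := ENNReal.toReal_pos (by simpa) (by simpa)
        have : (0 : ℝ) < d := by exact_mod_cast hd
        nlinarith)
    simpa using this
  obtain ⟨M, hM0, hM⟩ := exists_weighted_gaussian_le (E := EuclideanSpace ℝ (Fin d)) hss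
  set A : EuclideanSpace ℝ (Fin d) → ℝ := fun x => ‖x‖ ^ s' * Real.exp (-(1 / 8 * ‖x‖ ^ 2))
  set B : EuclideanSpace ℝ (Fin d) → ℝ := fun x => ‖x‖ ^ (-s) * Real.exp (-(1 / 8 * ‖x‖ ^ 2))
  set G : EuclideanSpace ℝ (Fin d) → ℝ := fun x => Real.exp (-(1 / 8 * ‖x‖ ^ 2))
  have hAm : Measurable A := by fun_prop
  have hBm : Measurable B := by fun_prop
  have hGm : Measurable G := by fun_prop
  set κ : ℝ := (4 * Real.pi * 1) ^ (-(d : ℝ) / 2) with hκ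
  have hκ0 : 0 < κ := by positivity
  set K : ℝ≥0∞ := ‖κ * M‖ₑ * (eLpNorm A q volume * eLpNorm B r volume +
    max (∫⁻ y, ‖G y‖ₑ) (eLpNorm G r volume)) with hK
  have hKt : K ≠ ∞ := by
    refine (ENNReal.mul_lt_top enorm_lt_top (ENNReal.add_lt_top.2
      ⟨ENNReal.mul_lt_top hA hB, max_lt ?_ (hG r hr0)⟩)).ne
    rw [← eLpNorm_one_eq_lintegral_enorm]
    exact hG 1 one_ne_zero
  refine ⟨K.toReal + 1, by positivity, fun f hf => ?_⟩
  suffices weightedNorm (heatSemigroup 1 f) q s' ≤ K * weightedNorm f p s by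
    refine this.trans ?_
    gcongr
    rw [← ENNReal.ofReal_toReal hKt]
    refine ENNReal.ofReal_le_ofReal ?_
    rw [ENNReal.toReal_ofReal ENNReal.toReal_nonneg]
    linarith
  set F : EuclideanSpace ℝ (Fin d) → ℝ≥0∞ := fun y => ‖‖y‖ ^ s * ‖f y‖‖ₑ with hF
  have hFm : AEMeasurable F volume := (aemeasurable_rpow_norm_mul_norm hf s).enorm
  have hFp : eLpNorm F p volume = weightedNorm f p s := eLpNorm_enorm _
  set b : ℝ≥0∞ := ∫⁻ y, ‖B y‖ₑ * F y
  have hb : b ≤ eLpNorm B r volume * weightedNorm f p s := by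
    refine (lintegral_mul_le_eLpNorm_mul_eLpNorm (r := r) (p := p) (by fun_prop) hFm).trans ?_
    rw [eLpNorm_enorm, hFp]
  set conv : EuclideanSpace ℝ (Fin d) → ℝ≥0∞ := fun x => ∫⁻ y, ‖G (x - y)‖ₑ * F y
  have hcm : AEMeasurable conv volume :=
    aemeasurable_lintegral_sub_mul (G := fun z => ‖G z‖ₑ) (by fun_prop) hFm
  have hconv : eLpNorm conv q volume ≤
      max (∫⁻ y, ‖G y‖ₑ) (eLpNorm G r volume) * weightedNorm f p s := by
    have := eLpNorm_lintegral_sub_mul_le (r := r) hp hpq (G := fun z => ‖G z‖ₑ)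
      (by fun_prop) hFm
    rwa [eLpNorm_enorm, hFp] at this
  have hpt : ∀ᵐ x : EuclideanSpace ℝ (Fin d),
      ‖‖x‖ ^ s' * ‖heatSemigroup 1 f x‖‖ₑ ≤ ‖κ * M‖ₑ * ‖b * ‖A x‖ₑ + conv x‖ₑ := by
    filter_upwards [Measure.ae_ne volume (0 : EuclideanSpace ℝ (Fin d))] with x hx
    rw [enorm_mul, enorm_norm, heatSemigroup_eq_integral, enorm_eq_self]
    calc ‖‖x‖ ^ s'‖ₑ * ‖∫ y, heatKernel d 1 (x - y) • f y‖ₑ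
        ≤ ‖‖x‖ ^ s'‖ₑ * ∫⁻ y, ‖heatKernel d 1 (x - y) • f y‖ₑ := by
          gcongr
          exact enorm_integral_le_lintegral_enorm _
      _ = ∫⁻ y, ‖‖x‖ ^ s'‖ₑ * ‖heatKernel d 1 (x - y) • f y‖ₑ :=
          (lintegral_const_mul' _ _ enorm_ne_top).symm
      _ ≤ ∫⁻ y, ‖κ * M‖ₑ * (‖A x‖ₑ * (‖B y‖ₑ * F y) + ‖G (x - y)‖ₑ * F y) := by
          refine lintegral_mono_ae ?_
          filter_upwards [Measure.ae_ne volume (0 : EuclideanSpace ℝ (Fin d))] with y hy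
          have hy0 : 0 < ‖y‖ := norm_pos_iff.2 hy
          have hx0 : 0 < ‖x‖ := norm_pos_iff.2 hx
          have hAB : 0 ≤ A x * B y := by positivity
          have hG0 : 0 ≤ G (x - y) := by positivity
          have e1 : ‖κ * M‖ₑ * (‖A x‖ₑ * (‖B y‖ₑ * F y) + ‖G (x - y)‖ₑ * F y) =
              ‖κ * M * (A x * B y + G (x - y)) * (‖y‖ ^ s * ‖f y‖)‖ₑ := by
            rw [enorm_mul _ (‖y‖ ^ s * ‖f y‖), enorm_mul (κ * M),
              Real.enorm_eq_ofReal (add_nonneg hAB hG0), ENNReal.ofReal_add hAB hG0,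
              ← Real.enorm_eq_ofReal hAB, ← Real.enorm_eq_ofReal hG0, enorm_mul (A x)]
            ring
          rw [e1, ← enorm_norm (heatKernel d 1 (x - y) • f y), ← enorm_mul]
          rw [enorm_le_iff_norm_le]
          rw [Real.norm_of_nonneg (by positivity), Real.norm_of_nonneg (by positivity),
            norm_smul, Real.norm_of_nonneg (heatKernel_nonneg one_pos _), heatKernel]
          have e2 : ‖x‖ ^ s' * ((4 * Real.pi * 1) ^ (-(d : ℝ) / 2) *
              Real.exp (-‖x - y‖ ^ 2 / (4 * 1)) * ‖f y‖) =
              κ * (‖x‖ ^ s' * Real.exp (-(‖x - y‖ ^ 2 / 4)) * ‖y‖ ^ (-s)) *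
                (‖y‖ ^ s * ‖f y‖) := by
            have h1 : ‖y‖ ^ (-s) * ‖y‖ ^ s = 1 := by rw [← Real.rpow_add hy0]; simp
            have h2 : -‖x - y‖ ^ 2 / (4 * 1) = -(‖x - y‖ ^ 2 / 4) := by ring
            rw [h2, ← hκ]
            linear_combination -κ * ‖x‖ ^ s' * Real.exp (-(‖x - y‖ ^ 2 / 4)) * ‖f y‖ * h1
          rw [e2, mul_assoc κ M]
          exact mul_le_mul_of_nonneg_right (mul_le_mul_of_nonneg_left (hM x y hx hy) hκ0.le)
            (by positivity)
      _ = ‖κ * M‖ₑ * (b * ‖A x‖ₑ + conv x) := by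
          rw [lintegral_const_mul' _ _ enorm_ne_top, lintegral_add_left' (by fun_prop),
            lintegral_const_mul' _ _ enorm_ne_top, mul_comm b]
  have hum : AEStronglyMeasurable (fun x => b * ‖A x‖ₑ) volume :=
    AEMeasurable.aestronglyMeasurable (by fun_prop)
  calc weightedNorm (heatSemigroup 1 f) q s'
      ≤ ‖κ * M‖ₑ * eLpNorm (fun x => b * ‖A x‖ₑ + conv x) q volume :=
        eLpNorm_le_mul_eLpNorm_of_ae_le_mul'' q
          (hum.add hcm.aestronglyMeasurable) hpt
    _ ≤ ‖κ * M‖ₑ * (eLpNorm (fun x => b * ‖A x‖ₑ) q volume + eLpNorm conv q volume) := by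
        gcongr
        exact eLpNorm_add_le hum hcm.aestronglyMeasurable (hp.trans hpq)
    _ ≤ ‖κ * M‖ₑ * ((eLpNorm B r volume * weightedNorm f p s) * eLpNorm A q volume +
          max (∫⁻ y, ‖G y‖ₑ) (eLpNorm G r volume) * weightedNorm f p s) := by
        gcongr
        refine (eLpNorm_le_mul_eLpNorm_of_ae_le_mul'' q hAm.aestronglyMeasurable
          (.of_forall fun x => ?_)).trans (mul_le_mul_left hb _)
        simp
    _ = K * weightedNorm f p s := by rw [hK]; ring

theorem weightedNorm_comp_smul {R : ℝ} (hR : 0 < R) (f : EuclideanSpace ℝ (Fin d) → 𝕜)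
    (p : ℝ≥0∞) (s : ℝ) :
    weightedNorm (fun x => f (R • x)) p s =
      ENNReal.ofReal (R ^ (-s - d * (p⁻¹).toReal)) * weightedNorm f p s := by
  set u : EuclideanSpace ℝ (Fin d) → ℝ := fun x => ‖x‖ ^ s * ‖f x‖ with hu
  have e : (fun x : EuclideanSpace ℝ (Fin d) => ‖x‖ ^ s * ‖f (R • x)‖) =
      (R ^ (-s)) • (u ∘ (R • ·)) := by
    funext x
    simp only [hu, Pi.smul_apply, Function.comp, norm_smul, Real.norm_of_nonneg hR.le, smul_eq_mul]
    rw [Real.mul_rpow hR.le (norm_nonneg x)]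
    have : R ^ (-s) * R ^ s = 1 := by rw [← Real.rpow_add hR]; simp
    linear_combination -‖x‖ ^ s * ‖f (R • x)‖ * this
  have hemb : MeasurableEmbedding (fun x : EuclideanSpace ℝ (Fin d) => R • x) :=
    (Homeomorph.smulOfNeZero R hR.ne').measurableEmbedding
  have hd0 : 0 < (R ^ d)⁻¹ := by positivity
  rw [weightedNorm, e, eLpNorm_const_smul, ← hemb.eLpNorm_map_measure,
    Measure.map_addHaar_smul volume hR.ne', finrank_euclideanSpace, Fintype.card_fin,
    abs_of_pos hd0, eLpNorm_smul_measure_of_ne_zero (by simpa using hd0), smul_eq_mul, ← mul_assoc,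
    Real.enorm_eq_ofReal (by positivity), one_div, ENNReal.ofReal_rpow_of_pos hd0,
    ← ENNReal.ofReal_mul (by positivity), sub_eq_add_neg, Real.rpow_add hR,
    Real.inv_rpow (by positivity), ← Real.rpow_natCast, ← Real.rpow_mul hR.le,
    ← Real.rpow_neg hR.le]
  rfl

/-- Parabolic scaling of the heat semigroup. -/
theorem heatSemigroup_sqrt_smul {t : ℝ} (ht : 0 < t) (f : EuclideanSpace ℝ (Fin d) → 𝕜)
    (x : EuclideanSpace ℝ (Fin d)) :
    heatSemigroup t f (√t • x) = heatSemigroup 1 (fun y => f (√t • y)) x := by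
  have hR : 0 < √t := Real.sqrt_pos.2 ht
  rw [heatSemigroup_eq_integral, heatSemigroup_eq_integral]
  have h := Measure.integral_comp_smul volume
    (fun y => heatKernel d t (√t • x - y) • f y) (√t)
  have hd0 : 0 < (√t ^ d)⁻¹ := by positivity
  rw [finrank_euclideanSpace, Fintype.card_fin, abs_of_pos hd0] at h
  rw [eq_comm, inv_smul_eq_iff₀ (by positivity)] at h
  rw [h, ← integral_smul]
  refine integral_congr_ae (.of_forall fun y => ?_)
  simp only
  rw [← smul_sub, smul_smul]
  congr 1
  simp only [heatKernel, norm_smul, Real.norm_of_nonneg hR.le, mul_pow, Real.sq_sqrt ht.le]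
  have h1 : (4 * Real.pi * t) ^ (-(d : ℝ) / 2) =
      (4 * Real.pi * 1) ^ (-(d : ℝ) / 2) * (√t ^ d)⁻¹ := by
    rw [mul_one, Real.mul_rpow (by positivity) ht.le, Real.sqrt_eq_rpow, ← Real.rpow_natCast,
      ← Real.rpow_mul ht.le, ← Real.rpow_neg ht.le]
    congr 2
    ring
  rw [h1]
  have h2 : -(t * ‖x - y‖ ^ 2) / (4 * t) = -‖x - y‖ ^ 2 / (4 * 1) := by field_simp
  rw [h2]
  field_simp

theorem exists_weightedNorm_heatSemigroup_le (hd : 1 ≤ d) {p q : ℝ≥0∞} (hp : 1 ≤ p)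
    (hpq : p ≤ q) {s s' : ℝ} (h : AdmissibleWeights d p q s s') :
    ∃ C : ℝ, 0 < C ∧ ∀ f : EuclideanSpace ℝ (Fin d) → 𝕜, AEStronglyMeasurable f volume →
      ∀ t : ℝ, 0 < t → weightedNorm (heatSemigroup t f) q s' ≤
        ENNReal.ofReal
          (C * t ^ (-((d : ℝ) / 2) * ((p⁻¹).toReal - (q⁻¹).toReal) - (s - s') / 2)) *
        weightedNorm f p s := by
  obtain ⟨C, hC, hest⟩ := exists_weightedNorm_heatSemigroup_one_le (𝕜 := 𝕜) hd hp hpq h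
  refine ⟨C, hC, fun f hf t ht => ?_⟩
  have hR : 0 < √t := Real.sqrt_pos.2 ht
  have h1 := hest (fun y => f (√t • y))
    (hf.comp_quasiMeasurePreserving (Measure.quasiMeasurePreserving_smul volume hR.ne'))
  rw [weightedNorm_comp_smul hR,
    show heatSemigroup 1 (fun y => f (√t • y)) = fun x => heatSemigroup t f (√t • x) from
      funext fun x => (heatSemigroup_sqrt_smul ht f x).symm, weightedNorm_comp_smul hR] at h1
  set a := -s' - d * (q⁻¹).toReal
  have ha : ENNReal.ofReal (√t ^ (-a)) * ENNReal.ofReal (√t ^ a) = 1 := by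
    rw [← ENNReal.ofReal_mul (by positivity), ← Real.rpow_add hR]; simp
  calc weightedNorm (heatSemigroup t f) q s'
      = ENNReal.ofReal (√t ^ (-a)) * (ENNReal.ofReal (√t ^ a) *
          weightedNorm (heatSemigroup t f) q s') := by rw [← mul_assoc, ha, one_mul]
    _ ≤ ENNReal.ofReal (√t ^ (-a)) * (ENNReal.ofReal C *
          (ENNReal.ofReal (√t ^ (-s - d * (p⁻¹).toReal)) * weightedNorm f p s)) := by gcongr
    _ = _ := by
        rw [← mul_assoc, ← mul_assoc, ← ENNReal.ofReal_mul (by positivity),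
          ← ENNReal.ofReal_mul (by positivity)]
        congr 2
        rw [mul_right_comm, ← Real.rpow_add hR, mul_comm, Real.sqrt_eq_rpow, ← Real.rpow_mul ht.le]
        congr 2
        ring

end HeatSemigroup

/-! ### Optimality of the conditions -/

section Optimality

variable {𝕜 : Type*} [RCLike 𝕜] {d : ℕ}

/-- A nonnegative datum supported in a ball of radius `2` spreads its whole mass over that ball. -/
theorem mul_integral_le_norm_heatSemigroup {t : ℝ} (ht : 0 < t)
    {φ : EuclideanSpace ℝ (Fin d) → ℝ} (hφ : Integrable φ volume) (hφ0 : ∀ x, 0 ≤ φ x)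
    {a : EuclideanSpace ℝ (Fin d)} (hsupp : ∀ x, x ∉ Metric.ball a 2 → φ x = 0)
    {x : EuclideanSpace ℝ (Fin d)} (hx : x ∈ Metric.ball a 2) :
    (4 * Real.pi * t) ^ (-(d : ℝ) / 2) * Real.exp (-(4 / t)) * ∫ y, φ y ≤
      ‖heatSemigroup t (fun y => (φ y : 𝕜)) x‖ := by
  have e : heatSemigroup t (fun y => (φ y : 𝕜)) x =
      ((∫ y, heatKernel d t (x - y) * φ y : ℝ) : 𝕜) := by
    rw [heatSemigroup_eq_integral, ← integral_ofReal]
    refine integral_congr_ae (.of_forall fun y => ?_)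
    simp [RCLike.real_smul_eq_coe_mul]
  have hmeas : Measurable fun y => heatKernel d t (x - y) :=
    (measurable_heatKernel t).comp (measurable_const.sub measurable_id)
  have hint : Integrable (fun y => heatKernel d t (x - y) * φ y) volume := by
    refine hφ.bdd_mul (c := (4 * Real.pi * t) ^ (-(d : ℝ) / 2)) hmeas.aestronglyMeasurable
      (.of_forall fun y => ?_)
    rw [Real.norm_of_nonneg (heatKernel_nonneg ht _), heatKernel]
    refine mul_le_of_le_one_right (by positivity) (Real.exp_le_one_iff.2 ?_)
    rw [neg_div]
    exact neg_nonpos.2 (by positivity)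
  rw [e, RCLike.norm_ofReal, ← integral_const_mul]
  refine (integral_mono (hφ.const_mul _) hint fun y => ?_).trans (le_abs_self _)
  by_cases hy : y ∈ Metric.ball a 2
  · refine mul_le_mul_of_nonneg_right ?_ (hφ0 y)
    rw [heatKernel]
    refine mul_le_mul_of_nonneg_left (Real.exp_le_exp.2 ?_) (by positivity)
    have h4 : ‖x - y‖ ≤ 4 := by
      rw [Metric.mem_ball] at hx hy
      rw [← dist_eq_norm]
      linarith [dist_triangle_right x y a]
    rw [neg_div, neg_le_neg_iff, div_le_div_iff₀ (by positivity) ht]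
    have h16 : ‖x - y‖ ^ 2 ≤ 4 ^ 2 := by gcongr
    nlinarith [mul_le_mul_of_nonneg_right h16 ht.le]
  · simp [hsupp y hy]

/-- What a weighted estimate implies for nonnegative data supported in a ball of radius `2`. -/
theorem exists_integral_mul_eLpNorm_indicator_le {t : ℝ} (ht : 0 < t) {p q : ℝ≥0∞} {s s' C : ℝ}
    (hC : ∀ f : EuclideanSpace ℝ (Fin d) → 𝕜, MemWeightedLp f p s →
      weightedNorm (heatSemigroup t f) q s' ≤ ENNReal.ofReal C * weightedNorm f p s) :
    ∃ C' : ℝ, 0 < C' ∧ ∀ (a : EuclideanSpace ℝ (Fin d)) (φ : EuclideanSpace ℝ (Fin d) → ℝ),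
      Integrable φ volume → (∀ x, 0 ≤ φ x) → (∀ x, x ∉ Metric.ball a 2 → φ x = 0) →
      ENNReal.ofReal (∫ y, φ y) *
          eLpNorm ((Metric.ball a 2).indicator fun x => ‖x‖ ^ s') q volume ≤
        ENNReal.ofReal C' * eLpNorm (fun x => ‖x‖ ^ s * φ x) p volume := by
  set c := (4 * Real.pi * t) ^ (-(d : ℝ) / 2) * Real.exp (-(4 / t)) with hc
  have hc0 : 0 < c := by positivity
  refine ⟨max C 1 / c, by positivity, fun a φ hφ hφ0 hsupp => ?_⟩
  have hw : weightedNorm (fun x => (φ x : 𝕜)) p s = eLpNorm (fun x => ‖x‖ ^ s * φ x) p volume := by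
    simp [weightedNorm, abs_of_nonneg (hφ0 _)]
  rcases eq_or_ne (eLpNorm (fun x => ‖x‖ ^ s * φ x) p volume) ∞ with htop | htop
  · rw [htop, ENNReal.mul_top (by simp; positivity)]
    exact le_top
  have hI : 0 ≤ ∫ y, φ y := integral_nonneg hφ0
  have h1 := hC (fun x => (φ x : 𝕜)) ⟨RCLike.continuous_ofReal.comp_aestronglyMeasurable hφ.1, by rw [hw]; exact htop.lt_top⟩
  rw [hw] at h1
  have h2 : ENNReal.ofReal (c * ∫ y, φ y) *
      eLpNorm ((Metric.ball a 2).indicator fun x => ‖x‖ ^ s') q volume ≤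
      weightedNorm (heatSemigroup t fun x => (φ x : 𝕜)) q s' := by
    rw [← Real.enorm_eq_ofReal (by positivity), ← eLpNorm_const_smul]
    refine eLpNorm_mono fun x => ?_
    by_cases hx : x ∈ Metric.ball a 2
    · rw [Pi.smul_apply, Set.indicator_of_mem hx, smul_eq_mul, Real.norm_of_nonneg (by positivity),
        Real.norm_of_nonneg (by positivity), mul_comm]
      gcongr
      exact mul_integral_le_norm_heatSemigroup ht hφ hφ0 hsupp hx
    · rw [Pi.smul_apply, Set.indicator_of_notMem hx, smul_zero, norm_zero]
      exact norm_nonneg _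
  have h3 := h2.trans h1
  have hcc : ENNReal.ofReal c⁻¹ * ENNReal.ofReal c = 1 := by
    rw [← ENNReal.ofReal_mul (by positivity), inv_mul_cancel₀ hc0.ne', ENNReal.ofReal_one]
  calc ENNReal.ofReal (∫ y, φ y) *
          eLpNorm ((Metric.ball a 2).indicator fun x => ‖x‖ ^ s') q volume
      = ENNReal.ofReal c⁻¹ * (ENNReal.ofReal (c * ∫ y, φ y) *
          eLpNorm ((Metric.ball a 2).indicator fun x => ‖x‖ ^ s') q volume) := by
        rw [ENNReal.ofReal_mul hc0.le, ← mul_assoc, ← mul_assoc, hcc, one_mul]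
    _ ≤ ENNReal.ofReal c⁻¹ * (ENNReal.ofReal (max C 1) *
          eLpNorm (fun x => ‖x‖ ^ s * φ x) p volume) := by
        refine mul_le_mul_right (h3.trans ?_) _
        gcongr
        exact le_max_left _ _
    _ = _ := by
        rw [← mul_assoc, ← ENNReal.ofReal_mul (by positivity)]
        congr 2
        ring

theorem rpow_mem_Icc_of_mem_Icc {R u : ℝ} (hR : 0 < R) (h1 : R / 2 ≤ u) (h2 : u ≤ 2 * R) (s : ℝ) :
    2 ^ (-|s|) * R ^ s ≤ u ^ s ∧ u ^ s ≤ 2 ^ |s| * R ^ s := by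
  have hu : 0 < u := by linarith
  rcases le_total 0 s with hs | hs
  · rw [abs_of_nonneg hs, Real.rpow_neg zero_le_two, ← Real.inv_rpow zero_le_two,
      ← Real.mul_rpow (by norm_num) hR.le, ← Real.mul_rpow zero_le_two hR.le]
    exact ⟨Real.rpow_le_rpow (by positivity) (by linarith) hs, Real.rpow_le_rpow hu.le h2 hs⟩
  · rw [abs_of_nonpos hs, neg_neg, Real.rpow_neg zero_le_two, ← Real.inv_rpow zero_le_two,
      ← Real.mul_rpow zero_le_two hR.le, ← Real.mul_rpow (by norm_num) hR.le]
    exact ⟨Real.rpow_le_rpow_of_nonpos hu h2 hs,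
      Real.rpow_le_rpow_of_nonpos (by positivity) (by linarith) hs⟩

theorem eLpNorm_rpow_norm_mul_indicator_ball_le {a : EuclideanSpace ℝ (Fin d)} {ρ R : ℝ}
    (hR : 0 < R) (hball : ∀ x ∈ Metric.ball a ρ, R / 2 ≤ ‖x‖ ∧ ‖x‖ ≤ 2 * R) (p : ℝ≥0∞) (s : ℝ) :
    eLpNorm (fun x => ‖x‖ ^ s * (Metric.ball a ρ).indicator (fun _ => (1 : ℝ)) x) p volume ≤
      ENNReal.ofReal (2 ^ |s| * R ^ s) * volume (Metric.ball a ρ) ^ (1 / p.toReal) := by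
  rw [← Real.enorm_eq_ofReal (by positivity)]
  refine le_trans (eLpNorm_mono fun x => ?_)
    (eLpNorm_indicator_const_le (s := Metric.ball a ρ) (2 ^ |s| * R ^ s) p)
  by_cases hx : x ∈ Metric.ball a ρ
  · rw [Set.indicator_of_mem hx, Set.indicator_of_mem hx, mul_one,
      Real.norm_of_nonneg (by positivity), Real.norm_of_nonneg (by positivity)]
    exact (rpow_mem_Icc_of_mem_Icc hR (hball x hx).1 (hball x hx).2 s).2
  · simp [hx]

theorem integral_indicator_ball_one (a : EuclideanSpace ℝ (Fin d)) (ρ : ℝ) :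
    Integrable ((Metric.ball a ρ).indicator fun _ => (1 : ℝ)) volume ∧
      ∫ y, (Metric.ball a ρ).indicator (fun _ => (1 : ℝ)) y = volume.real (Metric.ball a ρ) := by
  refine ⟨(integrable_indicator_iff measurableSet_ball).2
    (integrableOn_const measure_ball_lt_top.ne), ?_⟩
  rw [integral_indicator measurableSet_ball]
  simp

/-- The lower bound on `s'` is forced by a datum supported away from the origin: its evolution is
bounded below near the origin. -/
theorem lower_condition_of_estimate (hd : 1 ≤ d) {p q : ℝ≥0∞} (hq : q ≠ 0) {s s' C' : ℝ}
    (h : ∀ (a : EuclideanSpace ℝ (Fin d)) (φ : EuclideanSpace ℝ (Fin d) → ℝ),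
      Integrable φ volume → (∀ x, 0 ≤ φ x) → (∀ x, x ∉ Metric.ball a 2 → φ x = 0) →
      ENNReal.ofReal (∫ y, φ y) *
          eLpNorm ((Metric.ball a 2).indicator fun x => ‖x‖ ^ s') q volume ≤
        ENNReal.ofReal C' * eLpNorm (fun x => ‖x‖ ^ s * φ x) p volume) :
    -(d : ℝ) * (q⁻¹).toReal < s' ∨ (q = ∞ ∧ 0 ≤ s') := by
  have : Nonempty (Fin d) := ⟨⟨0, hd⟩⟩
  by_contra hcon
  obtain ⟨e, he⟩ := exists_norm_eq (EuclideanSpace ℝ (Fin d)) (show (0 : ℝ) ≤ 3 / 2 by norm_num)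
  have hball : ∀ x ∈ Metric.ball e (1 / 2), 1 ≤ ‖x‖ ∧ ‖x‖ < 2 := by
    intro x hx
    rw [mem_ball_iff_norm] at hx
    have h1 := norm_le_norm_add_norm_sub' x e
    have h2 := norm_le_norm_add_norm_sub' e x
    rw [norm_sub_rev] at h2
    constructor <;> linarith
  obtain ⟨hint, hval⟩ := integral_indicator_ball_one e (1 / 2)
  have h1 := h 0 _ hint (fun x => Set.indicator_nonneg (fun _ _ => zero_le_one) x) fun x hx => by
    refine Set.indicator_of_notMem (fun hx' => hx ?_) _
    simpa using (hball x hx').2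
  have htop : eLpNorm ((Metric.ball (0 : EuclideanSpace ℝ (Fin d)) 2).indicator
      fun x => ‖x‖ ^ s') q volume = ∞ := by
    rw [eq_top_iff, ← eLpNorm_indicator_ball_rpow_norm_eq_top hd hq hcon]
    refine eLpNorm_mono fun x => ?_
    exact norm_indicator_le_of_subset (Metric.ball_subset_ball one_le_two) _ _
  have hpos : 0 < volume.real (Metric.ball e (1 / 2)) :=
    ENNReal.toReal_pos (Metric.measure_ball_pos _ _ (by norm_num)).ne' measure_ball_lt_top.ne
  rw [htop, hval, ENNReal.mul_top (by simpa using hpos), top_le_iff] at h1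
  refine absurd h1 (ENNReal.mul_lt_top ENNReal.ofReal_lt_top
    ((eLpNorm_rpow_norm_mul_indicator_ball_le one_pos (fun x hx => ?_) p s).trans_lt ?_)).ne
  · constructor <;> linarith [hball x hx]
  · exact ENNReal.mul_lt_top ENNReal.ofReal_lt_top
      (ENNReal.rpow_lt_top_of_nonneg (by positivity) measure_ball_lt_top.ne)

theorem exists_ge_lt_rpow {a : ℝ} (ha : 0 < a) (R₀ K : ℝ) : ∃ R, R₀ ≤ R ∧ K < R ^ a :=
  ((Filter.eventually_ge_atTop R₀).and
    ((tendsto_rpow_atTop ha).eventually_gt_atTop K)).exists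

/-- `s' ≤ s` is forced by moving a fixed datum to infinity. -/
theorem le_of_estimate (hd : 1 ≤ d) {p q : ℝ≥0∞} (hq : q ≠ 0) {s s' C' : ℝ} (hC' : 0 < C')
    (h : ∀ (a : EuclideanSpace ℝ (Fin d)) (φ : EuclideanSpace ℝ (Fin d) → ℝ),
      Integrable φ volume → (∀ x, 0 ≤ φ x) → (∀ x, x ∉ Metric.ball a 2 → φ x = 0) →
      ENNReal.ofReal (∫ y, φ y) *
          eLpNorm ((Metric.ball a 2).indicator fun x => ‖x‖ ^ s') q volume ≤
        ENNReal.ofReal C' * eLpNorm (fun x => ‖x‖ ^ s * φ x) p volume) : s' ≤ s := by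
  have : Nonempty (Fin d) := ⟨⟨0, hd⟩⟩
  by_contra! hcon
  set v := volume.real (Metric.ball (0 : EuclideanSpace ℝ (Fin d)) 2) with hv
  have hv0 : 0 < v :=
    ENNReal.toReal_pos (Metric.measure_ball_pos _ _ (by norm_num)).ne' measure_ball_lt_top.ne
  obtain ⟨R, hR4, hR⟩ := exists_ge_lt_rpow (sub_pos.2 hcon) 4
    (C' * (2 ^ |s| * v ^ (1 / p.toReal)) / (v * (2 ^ (-|s'|) * v ^ (1 / q.toReal))))
  have hR0 : 0 < R := by linarith
  obtain ⟨a, ha⟩ := exists_norm_eq (EuclideanSpace ℝ (Fin d)) hR0.le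
  have hvol : volume (Metric.ball a 2) = ENNReal.ofReal v := by
    rw [hv, Measure.real, ENNReal.ofReal_toReal measure_ball_lt_top.ne,
      Measure.addHaar_ball_center]
  have hball : ∀ x ∈ Metric.ball a 2, R / 2 ≤ ‖x‖ ∧ ‖x‖ ≤ 2 * R := by
    intro x hx
    rw [mem_ball_iff_norm] at hx
    have h1 := norm_le_norm_add_norm_sub' x a
    have h2 := norm_le_norm_add_norm_sub' a x
    rw [norm_sub_rev] at h2
    constructor <;> linarith
  obtain ⟨hint, hval⟩ := integral_indicator_ball_one a 2
  have h1 := h a _ hint (fun x => Set.indicator_nonneg (fun _ _ => zero_le_one) x) fun x hx =>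
    Set.indicator_of_notMem hx _
  have hlow : ENNReal.ofReal (2 ^ (-|s'|) * R ^ s') * ENNReal.ofReal v ^ (1 / q.toReal) ≤
      eLpNorm ((Metric.ball a 2).indicator fun x => ‖x‖ ^ s') q volume := by
    rw [← hvol, ← Real.enorm_eq_ofReal (by positivity), ← eLpNorm_indicator_const'
      measurableSet_ball (Metric.measure_ball_pos _ _ (by norm_num)).ne' hq]
    refine eLpNorm_mono fun x => ?_
    by_cases hx : x ∈ Metric.ball a 2
    · rw [Set.indicator_of_mem hx, Set.indicator_of_mem hx,
        Real.norm_of_nonneg (by positivity), Real.norm_of_nonneg (by positivity)]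
      exact (rpow_mem_Icc_of_mem_Icc hR0 (hball x hx).1 (hball x hx).2 s').1
    · simp [hx]
  have hup := eLpNorm_rpow_norm_mul_indicator_ball_le hR0 hball p s
  have h2 := (mul_le_mul_right hlow _).trans (h1.trans (mul_le_mul_right hup _))
  rw [hval, Measure.real, hvol, ENNReal.toReal_ofReal hv0.le,
    ENNReal.ofReal_rpow_of_pos hv0, ENNReal.ofReal_rpow_of_pos hv0,
    ← ENNReal.ofReal_mul (by positivity), ← ENNReal.ofReal_mul (by positivity),
    ← ENNReal.ofReal_mul (by positivity), ← ENNReal.ofReal_mul (by positivity),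
    ENNReal.ofReal_le_ofReal_iff (by positivity)] at h2
  rw [Real.rpow_sub hR0, div_lt_div_iff₀ (by positivity) (by positivity)] at hR
  nlinarith

/-- For `b p ≥ δ - d`, the `L^p` norm of `|x|^b` on the unit ball is at most that of
`|x|^{(δ-d)/p}`. -/
theorem eLpNorm_indicator_ball_rpow_norm_le (hd : 1 ≤ d) {p : ℝ≥0∞} (hp : p ≠ 0) (hp' : p ≠ ∞)
    {b δ : ℝ} (hδ : 0 < δ) (hb : -(d : ℝ) + δ ≤ b * p.toReal) :
    eLpNorm ((Metric.ball (0 : EuclideanSpace ℝ (Fin d)) 1).indicator fun x => ‖x‖ ^ b) p volume ≤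
      ENNReal.ofReal ((d * volume.real (Metric.ball (0 : EuclideanSpace ℝ (Fin d)) 1) / δ) ^
        (p.toReal⁻¹)) := by
  have : Nonempty (Fin d) := ⟨⟨0, hd⟩⟩
  have hpr : 0 < p.toReal := ENNReal.toReal_pos hp hp'
  rw [eLpNorm_indicator_eq_eLpNorm_restrict measurableSet_ball,
    eLpNorm_eq_lintegral_rpow_enorm_toReal hp hp', one_div,
    ← ENNReal.ofReal_rpow_of_nonneg (by positivity) (by positivity)]
  gcongr
  have hval := integral_ball_rpow_norm hd (show -(d : ℝ) < -d + δ by linarith)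
  rw [show (d : ℝ) + (-d + δ) = δ by ring] at hval
  rw [← hval, ofReal_integral_eq_lintegral_ofReal
    ((integrableOn_ball_rpow_norm_iff hd).2 (by linarith)) (.of_forall fun x => by positivity)]
  refine lintegral_mono_ae ?_
  filter_upwards [ae_restrict_mem measurableSet_ball,
    ae_restrict_of_ae (Measure.ae_ne volume (0 : EuclideanSpace ℝ (Fin d)))] with x hx hx0
  have hx1 : ‖x‖ < 1 := by simpa using hx
  rw [Real.enorm_eq_ofReal (by positivity), ENNReal.ofReal_rpow_of_nonneg (by positivity) hpr.le,
    ← Real.rpow_mul (norm_nonneg x)]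
  exact ENNReal.ofReal_le_ofReal
    (Real.rpow_le_rpow_of_exponent_ge (norm_pos_iff.2 hx0) hx1.le hb)

/-- When the upper bound on `s` fails, the weighted norms of `|x|^{-d+ε} 1_{|x|<1}` grow more
slowly than the integrals of these functions, which are of order `1/ε`. -/
theorem exists_eLpNorm_rpow_norm_mul_indicator_le (hd : 1 ≤ d) {p : ℝ≥0∞} (hp : 1 ≤ p) {s : ℝ}
    (h : ¬ (s < (d : ℝ) * (1 - (p⁻¹).toReal) ∨ (p = 1 ∧ s ≤ 0))) :
    ∃ K θ : ℝ, θ < 1 ∧ ∀ ε : ℝ, 0 < ε →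
      eLpNorm (fun x : EuclideanSpace ℝ (Fin d) =>
        ‖x‖ ^ s * (Metric.ball 0 1).indicator (fun x => ‖x‖ ^ (-(d : ℝ) + ε)) x) p volume ≤
      ENNReal.ofReal (K * ε ^ (-θ)) := by
  have : Nonempty (Fin d) := ⟨⟨0, hd⟩⟩
  push Not at h
  obtain ⟨h1, h2⟩ := h
  have hcongr : ∀ ε : ℝ, eLpNorm (fun x : EuclideanSpace ℝ (Fin d) =>
        ‖x‖ ^ s * (Metric.ball 0 1).indicator (fun x => ‖x‖ ^ (-(d : ℝ) + ε)) x) p volume =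
      eLpNorm ((Metric.ball (0 : EuclideanSpace ℝ (Fin d)) 1).indicator
        fun x => ‖x‖ ^ (s + (-(d : ℝ) + ε))) p volume := by
    intro ε
    refine eLpNorm_congr_ae ?_
    filter_upwards [Measure.ae_ne volume (0 : EuclideanSpace ℝ (Fin d))] with x hx
    by_cases hxb : x ∈ Metric.ball (0 : EuclideanSpace ℝ (Fin d)) 1
    · rw [Set.indicator_of_mem hxb, Set.indicator_of_mem hxb, Real.rpow_add (norm_pos_iff.2 hx) s]
    · rw [Set.indicator_of_notMem hxb, Set.indicator_of_notMem hxb, mul_zero]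
  simp_rw [hcongr]
  have hp0 : p ≠ 0 := (zero_lt_one.trans_le hp).ne'
  set D := d * volume.real (Metric.ball (0 : EuclideanSpace ℝ (Fin d)) 1)
  have hD : 0 ≤ D := by positivity
  rcases eq_or_ne p ∞ with rfl | hpt
  · refine ⟨1, 0, one_pos, fun ε hε => ?_⟩
    rw [neg_zero, Real.rpow_zero, mul_one, eLpNorm_exponent_top]
    refine eLpNormEssSup_le_of_ae_bound (.of_forall fun x => ?_)
    by_cases hxb : x ∈ Metric.ball (0 : EuclideanSpace ℝ (Fin d)) 1
    · rw [Set.indicator_of_mem hxb, Real.norm_of_nonneg (by positivity)]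
      have hx1 : ‖x‖ < 1 := by simpa using hxb
      simp only [ENNReal.inv_top, ENNReal.toReal_zero, sub_zero, mul_one] at h1
      exact Real.rpow_le_one (norm_nonneg x) hx1.le (by linarith)
    · simp [hxb]
  have hpr : 0 < p.toReal := ENNReal.toReal_pos hp0 hpt
  rcases eq_or_ne p 1 with rfl | hp1
  · have hs := h2 rfl
    refine ⟨D / s, 0, one_pos, fun ε hε => ?_⟩
    refine (eLpNorm_indicator_ball_rpow_norm_le hd hp0 hpt hs ?_).trans (le_of_eq ?_)
    · rw [ENNReal.toReal_one]; linarith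
    · simp [D]
  · have hpr1 : 1 < p.toReal := by
      simpa using (ENNReal.toReal_lt_toReal ENNReal.one_ne_top hpt).2 (lt_of_le_of_ne hp hp1.symm)
    refine ⟨(D / p.toReal) ^ p.toReal⁻¹, p.toReal⁻¹, inv_lt_one_of_one_lt₀ hpr1, fun ε hε => ?_⟩
    refine (eLpNorm_indicator_ball_rpow_norm_le hd hp0 hpt
      (show 0 < ε * p.toReal by positivity) ?_).trans (le_of_eq ?_)
    · have h3 := mul_le_mul_of_nonneg_right h1 hpr.le
      rw [ENNReal.toReal_inv, mul_assoc, sub_mul, inv_mul_cancel₀ hpr.ne'] at h3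
      linarith
    · rw [Real.rpow_neg hε.le, ← Real.inv_rpow hε.le,
        ← Real.mul_rpow (by positivity) (by positivity)]
      congr 2
      simp only [D]
      field_simp

/-- The upper bound on `s` is forced by data concentrating at the origin. -/
theorem upper_condition_of_estimate (hd : 1 ≤ d) {p q : ℝ≥0∞} (hp : 1 ≤ p) (hq : q ≠ 0)
    {s s' C' : ℝ}
    (h : ∀ (a : EuclideanSpace ℝ (Fin d)) (φ : EuclideanSpace ℝ (Fin d) → ℝ),
      Integrable φ volume → (∀ x, 0 ≤ φ x) → (∀ x, x ∉ Metric.ball a 2 → φ x = 0) →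
      ENNReal.ofReal (∫ y, φ y) *
          eLpNorm ((Metric.ball a 2).indicator fun x => ‖x‖ ^ s') q volume ≤
        ENNReal.ofReal C' * eLpNorm (fun x => ‖x‖ ^ s * φ x) p volume) :
    s < (d : ℝ) * (1 - (p⁻¹).toReal) ∨ (p = 1 ∧ s ≤ 0) := by
  have : Nonempty (Fin d) := ⟨⟨0, hd⟩⟩
  by_contra hcon
  obtain ⟨K, θ, hθ, hK⟩ := exists_eLpNorm_rpow_norm_mul_indicator_le hd hp hcon
  set D := d * volume.real (Metric.ball (0 : EuclideanSpace ℝ (Fin d)) 1) with hD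
  have hD0 : 0 < D := by
    have : 0 < volume.real (Metric.ball (0 : EuclideanSpace ℝ (Fin d)) 1) :=
      ENNReal.toReal_pos (Metric.measure_ball_pos _ _ (by norm_num)).ne' measure_ball_lt_top.ne
    have : (0 : ℝ) < d := by exact_mod_cast hd
    positivity
  have hW : eLpNorm ((Metric.ball (0 : EuclideanSpace ℝ (Fin d)) 2).indicator
      fun x => ‖x‖ ^ s') q volume ≠ 0 := by
    rw [Ne, eLpNorm_eq_zero_iff
      (Measurable.indicator (by fun_prop) measurableSet_ball).aestronglyMeasurable hq]
    intro h0
    have : ∀ᵐ x : EuclideanSpace ℝ (Fin d), x ∉ Metric.ball 0 2 := by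
      filter_upwards [h0, Measure.ae_ne volume (0 : EuclideanSpace ℝ (Fin d))] with x hx hx0 hxb
      rw [Set.indicator_of_mem hxb] at hx
      exact (Real.rpow_pos_of_pos (norm_pos_iff.2 hx0) s').ne' hx
    exact (Metric.measure_ball_pos volume (0 : EuclideanSpace ℝ (Fin d)) two_pos).ne'
      (measure_eq_zero_iff_ae_notMem.2 this)
  obtain ⟨w, hw0, hw⟩ := ENNReal.lt_iff_exists_nnreal_btwn.1 (pos_iff_ne_zero.2 hW)
  have hw0 : (0 : ℝ) < w := by exact_mod_cast hw0
  obtain ⟨R, hR1, hR⟩ := exists_ge_lt_rpow (sub_pos.2 hθ) 1 (max C' 0 * max K 0 / (D * w))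
  have hR0 : 0 < R := by linarith
  have hε : 0 < R⁻¹ := inv_pos.2 hR0
  have h1 := h 0 ((Metric.ball (0 : EuclideanSpace ℝ (Fin d)) 1).indicator
      fun x => ‖x‖ ^ (-(d : ℝ) + R⁻¹))
    ((integrable_indicator_iff measurableSet_ball).2
      ((integrableOn_ball_rpow_norm_iff hd).2 (by linarith)))
    (fun x => Set.indicator_nonneg (fun _ _ => by positivity) x)
    fun x hx => Set.indicator_of_notMem
      (fun hx' => hx (Metric.ball_subset_ball one_le_two hx')) _
  rw [integral_indicator measurableSet_ball, integral_ball_rpow_norm hd (by linarith), ← hD,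
    show (d : ℝ) + (-d + R⁻¹) = R⁻¹ by ring, div_inv_eq_mul] at h1
  have h2 : ENNReal.ofReal (D * R) * ENNReal.ofReal w ≤
      ENNReal.ofReal (max C' 0) * ENNReal.ofReal (max K 0 * R⁻¹ ^ (-θ)) := by
    refine le_trans ?_ (h1.trans ?_)
    · gcongr
      simpa using hw.le
    · refine mul_le_mul' (ENNReal.ofReal_le_ofReal (le_max_left _ _)) ((hK _ hε).trans ?_)
      refine ENNReal.ofReal_le_ofReal ?_
      gcongr
      exact le_max_left _ _
  rw [← ENNReal.ofReal_mul (by positivity), ← ENNReal.ofReal_mul (by positivity),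
    ENNReal.ofReal_le_ofReal_iff (by positivity), Real.inv_rpow hR0.le, Real.rpow_neg hR0.le,
    inv_inv] at h2
  rw [Real.rpow_sub hR0, Real.rpow_one, div_lt_div_iff₀ (by positivity) (by positivity)] at hR
  nlinarith

end Optimality

theorem lemma2p1 {𝕜 : Type*} [RCLike 𝕜] (d : ℕ) (hd : 1 ≤ d) (p q : ℝ≥0∞)
    (hp : 1 ≤ p) (hpq : p ≤ q) (s s' : ℝ) :
    (AdmissibleWeights d p q s s' →
      ∃ C : ℝ, 0 < C ∧
        ∀ f : EuclideanSpace ℝ (Fin d) → 𝕜, MemWeightedLp f p s → ∀ t : ℝ, 0 < t →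
          (∀ x, HeatDefinedAt t f x) ∧
          MemWeightedLp (heatSemigroup t f) q s' ∧
          weightedNorm (heatSemigroup t f) q s' ≤
            ENNReal.ofReal
              (C * t ^ (-((d : ℝ) / 2) * ((p⁻¹).toReal - (q⁻¹).toReal) - (s - s') / 2)) *
            weightedNorm f p s) ∧
    (¬ AdmissibleWeights d p q s s' →
      ∀ t : ℝ, 0 < t → ¬ ∃ C : ℝ,
        ∀ f : EuclideanSpace ℝ (Fin d) → 𝕜, MemWeightedLp f p s →
          (∀ᵐ x ∂volume, HeatDefinedAt t f x) ∧
          weightedNorm (heatSemigroup t f) q s' ≤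
            ENNReal.ofReal C * weightedNorm f p s) := by
  have hq0 : q ≠ 0 := (zero_lt_one.trans_le (hp.trans hpq)).ne'
  refine ⟨fun h => ?_, fun h t ht ⟨C, hC⟩ => h ?_⟩
  · obtain ⟨C, hC, hest⟩ := exists_weightedNorm_heatSemigroup_le (𝕜 := 𝕜) hd hp hpq h
    refine ⟨C, hC, fun f hf t ht => ⟨heatDefinedAt_of_memWeightedLp hd hp h.2.2 hf ht, ?_,
      hest f hf.1 t ht⟩⟩
    exact ⟨aestronglyMeasurable_heatSemigroup t hf.1,
      (hest f hf.1 t ht).trans_lt (ENNReal.mul_lt_top ENNReal.ofReal_lt_top hf.2)⟩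
  · obtain ⟨C', hC', hest⟩ := exists_integral_mul_eLpNorm_indicator_le ht fun f hf => (hC f hf).2
    exact ⟨lower_condition_of_estimate hd hq0 hest, le_of_estimate hd hq0 hC' hest,
      upper_condition_of_estimate hd hp hq0 hest⟩
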